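/- Let $K=\mathbf{Q}(\sqrt5)\subset\mathbf{C}$, let $\varepsilon=\frac{1+\sqrt5}{2}$ and $\widetilde\varepsilon=\frac{1-\sqrt5}{2}$, and put $\pi_{11}=1-3\varepsilon$, $\widetilde\pi_{11}=1-3\widetilde\varepsilon$, $q=\pi_{11}/\widetilde\pi_{11}$ and $r=\varepsilon/\widetilde\varepsilon=-\varepsilon^2$. For integers $i,j\ge 1$ let $$F_{i,j}=K(\zeta_{ij},\,r^{1/ij},\,q^{1/i})\subset\mathbf{C},$$ where $\zeta_{ij}$ is any primitive $ij$-th root of unity, $r^{1/ij}$ is any $ij$-th root of $r$, and $q^{1/i}$ is any $i$-th root of $q$ in $\mathbf{C}$. Then for all integers $i,j\ge1$ and all such choices of roots, $$[F_{i,j}:\mathbf{Q}]=2^{1-t}\,i^2\,j\,\varphi(ij),$$ where $\varphi$ is Euler's totient function and $$t=t_{i,j}=\begin{cases}\#\{d\in\{4,5,11\}: d\mid ij\} & \text{if } i \text{ is even};\\ \#\{d\in\{4,5\}: d\mid ij\} & \text{if } i \text{ is odd and } j \text{ is even};\\ \#\{d\in\{5\}: d\mid ij\} & \text{if } ij \text{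 is odd}.\end{cases}$$ -/

import Mathlib

/-- The fundamental unit `ε = (1 + √5) / 2`, as a complex number. -/
noncomputable def goldenUnit : ℂ := (1 + (Real.sqrt 5 : ℂ)) / 2

/-- The conjugate `ε̃ = (1 - √5) / 2` of `ε`. -/
noncomputable def goldenUnitConj : ℂ := (1 - (Real.sqrt 5 : ℂ)) / 2

/-- The prime element `π₁₁ = 1 - 3ε` of `ℤ[ε]`, of norm `-11`. -/
noncomputable def primeEleven : ℂ := 1 - 3 * goldenUnit

/-- The conjugate `π̃₁₁ = 1 - 3ε̃` of `π₁₁`. -/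
noncomputable def primeElevenConj : ℂ := 1 - 3 * goldenUnitConj

/-- `q = π₁₁ / π̃₁₁`. -/
noncomputable def qElt : ℂ := primeEleven / primeElevenConj

/-- `r = -ε²`. -/
noncomputable def rElt : ℂ := -goldenUnit ^ 2

theorem sqrt_five_sq_complex : (Real.sqrt 5 : ℂ) ^ 2 = 5 := by
  have h : Real.sqrt 5 ^ 2 = 5 := Real.sq_sqrt (by norm_num)
  exact_mod_cast h

/-- The norm of `ε` is `-1`. -/
theorem goldenUnit_mul_conj : goldenUnit * goldenUnitConj = -1 := by
  unfold goldenUnit goldenUnitConj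
  linear_combination (-1 / 4 : ℂ) * sqrt_five_sq_complex

/-- The norm of `π₁₁` is `-11`; in particular the denominator of `q` is nonzero. -/
theorem primeEleven_mul_conj : primeEleven * primeElevenConj = -11 := by
  unfold primeEleven primeElevenConj goldenUnit goldenUnitConj
  linear_combination (-9 / 4 : ℂ) * sqrt_five_sq_complex

/-- The two descriptions of `r` agree: `ε / ε̃ = -ε²`. -/
theorem goldenUnit_div_conj : goldenUnit / goldenUnitConj = rElt := by
  have h0 : goldenUnitConj ≠ 0 := by
    intro h
    have h1 := goldenUnit_mul_conj
    rw [h] at h1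
    norm_num at h1
  rw [div_eq_iff h0]
  unfold rElt
  linear_combination goldenUnit * goldenUnit_mul_conj

/-- The real quadratic field `K = ℚ(√5)`, as a subfield of `ℂ`. -/
noncomputable def quadField : IntermediateField ℚ ℂ :=
  IntermediateField.adjoin ℚ {(Real.sqrt 5 : ℂ)}

/-- The field `K(ζ, ρ, κ) ⊆ ℂ`, regarded as an extension of `ℚ`. -/
noncomputable def radicalField (ζ ρ κ : ℂ) : IntermediateField ℚ ℂ :=
  (IntermediateField.adjoin quadField {ζ, ρ, κ}).restrictScalars ℚ

/-- The exponent `t = t_{i,j}`. -/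
def tExp (i j : ℕ) : ℕ :=
  if Even i then (({4, 5, 11} : Finset ℕ).filter (fun d => d ∣ i * j)).card
  else if Even j then (({4, 5} : Finset ℕ).filter (fun d => d ∣ i * j)).card
  else (({5} : Finset ℕ).filter (fun d => d ∣ i * j)).card

/-!
# The degree of `K(ζ_{ij}, r^{1/ij}, q^{1/i})` for `K = ℚ(√5)`

Put `n = ij` and `M = ℚ(√5, ζ_n)`. The degree of `M` is `φ(n)` or `2 φ(n)`, because
`√5` lies in `ℚ(ζ_n)` exactly when `5 ∣ n` (`finrank_adjoin_sqrt_five_root_of_unity`). Over `M` the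
field is a Kummer extension, generated by `ρ = r^{1/n}` and `κ = q^{1/i}`, so its degree is
the number of classes of monomials `ρ ^ a * κ ^ b` modulo `Mˣ` (`finrank_adjoin_pair_eq_mul`).

It remains to find the monomials in `M`. The elements `r` and `q` are real and have norm `1` to `ℚ`.
If `y = ρ ^ a * κ ^ b` lies in `M`, then `|y|` lies in a cyclotomic field, so all its conjugates are
real; as a power of `|y|` lies in `ℚ(√5)`, its conjugates over `ℚ(√5)` are `±|y|`, so that `w = |y|²`
lies in `ℚ(√5)`, and has norm `1`. Some power of `w` equals `r ^ (2a) * q ^ (2jb)`. Comparing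
valuations at `π₁₁`, and using that positive units of norm `1` are even powers of `ε`, one finds
`n ∣ 2a` and `i ∣ 2b` (`two_mul_dvd_of_mem`). So only the square roots of `r`, `q` and `r q` can
become cyclotomic. Up to factors in `ℚ(√5)` these are `√-1`, `√-11` and `√11`, and automorphisms
acting on roots of unity show that they lie in `M` only for the obvious reasons `4 ∣ n` and `11 ∣ n`
(`exponent_dvd_of_mem`). Each of the three conditions `5 ∣ n`, `4 ∣ n`, and `11 ∣ n` with `i` even,
therefore halves the degree once, and `tExp` counts them (`two_pow_tExp`).

Automorphisms are taken of the whole field `ℂ`: every embedding into `ℂ` of a countable subfield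
extends to one (`exists_ringEquiv_of_countable`).
-/

/-! ### Automorphisms of the complex numbers -/

/-- Two embeddings of a countable field into uncountable algebraically closed fields of the same
cardinality differ by an isomorphism of the latter: both have transcendence bases of that cardinality
over the countable field. -/
theorem exists_ringEquiv_of_countable {R K L : Type} [Field R] [Countable R] [Field K] [Field L]
    [IsAlgClosed K] [IsAlgClosed L] (f : R →+* K) (g : R →+* L)
    (hK : Cardinal.aleph0 < Cardinal.mk K) (hKL : Nonempty (K ≃ L)) :
    ∃ e : K ≃+* L, ∀ r, e (f r) = g r := by
  let := f.toAlgebra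
  let := g.toAlgebra
  obtain ⟨s, hs⟩ := exists_isTranscendenceBasis R K
  obtain ⟨t, ht⟩ := exists_isTranscendenceBasis R L
  have hR : Cardinal.mk R ≤ Cardinal.aleph0 := Cardinal.mk_le_aleph0
  have hL : Cardinal.aleph0 < Cardinal.mk L := by
    rwa [← Cardinal.mk_congr hKL.some]
  have hst : Cardinal.mk s = Cardinal.mk t := by
    rw [← IsAlgClosed.cardinal_eq_cardinal_transcendence_basis_of_aleph0_lt' _ hs hR hK,
      ← IsAlgClosed.cardinal_eq_cardinal_transcendence_basis_of_aleph0_lt' _ ht hR hL]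
    exact Cardinal.mk_congr hKL.some
  obtain ⟨e⟩ := Cardinal.eq.1 hst
  let e' : Algebra.adjoin R (Set.range ((↑) : s → K)) ≃ₐ[R]
      Algebra.adjoin R (Set.range ((↑) : t → L)) :=
    hs.1.aevalEquiv.symm.trans ((MvPolynomial.renameEquiv R e).trans ht.1.aevalEquiv)
  let := IsAlgClosed.isAlgClosure_of_transcendence_basis _ hs
  let := IsAlgClosed.isAlgClosure_of_transcendence_basis _ ht
  refine ⟨IsAlgClosure.equivOfEquiv K L e'.toRingEquiv, fun r => ?_⟩
  change IsAlgClosure.equivOfEquiv K L e'.toRingEquiv (algebraMap R K r) = algebraMap R L r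
  have h := IsAlgClosure.equivOfEquiv_algebraMap K L e'.toRingEquiv (algebraMap R _ r)
  rw [← IsScalarTower.algebraMap_apply] at h
  rw [h]
  change algebraMap _ L (e' (algebraMap R _ r)) = _
  rw [e'.commutes, ← IsScalarTower.algebraMap_apply]

theorem countable_of_isAlgebraic (F E : Type) [Field F] [Field E] [Algebra F E] [Countable F]
    [Algebra.IsAlgebraic F E] : Countable E :=
  Cardinal.mk_le_aleph0_iff.1 ((Algebra.IsAlgebraic.cardinalMk_le_max F E).trans
    (max_le Cardinal.mk_le_aleph0 le_rfl))

theorem exists_algEquiv_complex_of_isConjRoot {F : Type} [Field F] [Countable F] [Algebra F ℂ]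
    {α β : ℂ} (hα : IsIntegral F α) (h : IsConjRoot F α β) : ∃ σ : ℂ ≃ₐ[F] ℂ, σ α = β := by
  let f : IntermediateField.adjoin F {α} →ₐ[F] ℂ :=
    (IntermediateField.algHomAdjoinIntegralEquiv F hα).symm
      ⟨β, (isConjRoot_iff_mem_minpoly_aroots hα).1 h⟩
  have hf : f (IntermediateField.AdjoinSimple.gen F α) = β :=
    IntermediateField.algHomAdjoinIntegralEquiv_symm_apply_gen F hα _
  have : Algebra.IsAlgebraic F (IntermediateField.adjoin F {α}) :=
    IntermediateField.isAlgebraic_adjoin_simple hα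
  have : Countable (IntermediateField.adjoin F {α}) := countable_of_isAlgebraic F _
  have hC : Cardinal.aleph0 < Cardinal.mk ℂ := by
    rw [Cardinal.mk_complex]
    exact Cardinal.aleph0_lt_continuum
  obtain ⟨e, he⟩ := exists_ringEquiv_of_countable
    (algebraMap (IntermediateField.adjoin F {α}) ℂ) f.toRingHom hC ⟨Equiv.refl ℂ⟩
  exact ⟨AlgEquiv.ofRingEquiv (f := e) fun r => (he (algebraMap F _ r)).trans (f.commutes r),
    (he (IntermediateField.AdjoinSimple.gen F α)).trans hf⟩

/-- The Galois correspondence inside `ℂ` for countable `F`: an algebraic number fixed by all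
`F`-automorphisms of `ℂ` lies in `F`. -/
theorem mem_range_algebraMap_of_forall_algEquiv_eq {F : Type} [Field F] [Countable F]
    [Algebra F ℂ] {x : ℂ} (hx : IsIntegral F x) (h : ∀ σ : ℂ ≃ₐ[F] ℂ, σ x = x) :
    x ∈ (algebraMap F ℂ).range := by
  have : CharZero F := (algebraMap F ℂ).charZero
  by_contra hn
  have hb : x ∉ (⊥ : Subalgebra F ℂ) := fun hb => hn (Algebra.mem_bot.1 hb)
  obtain ⟨y, hxy, hc⟩ := (notMem_iff_exists_ne_and_isConjRoot
    (minpoly.irreducible hx).separable (IsAlgClosed.splits _)).1 hb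
  obtain ⟨σ, hσ⟩ := exists_algEquiv_complex_of_isConjRoot hx hc
  exact hxy ((h σ).symm.trans hσ)

theorem IsPrimitiveRoot.exists_algEquiv_eq_pow {m e : ℕ} {ζ : ℂ} (hζ : IsPrimitiveRoot ζ m)
    (hm : 0 < m) (he : e.Coprime m) : ∃ σ : ℂ ≃ₐ[ℚ] ℂ, σ ζ = ζ ^ e :=
  exists_algEquiv_complex_of_isConjRoot ((hζ.isIntegral hm).tower_top) <| by
    rw [isConjRoot_def, ← Polynomial.cyclotomic_eq_minpoly_rat hζ hm,
      ← Polynomial.cyclotomic_eq_minpoly_rat (hζ.pow_of_coprime e he) hm]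

/-- Cyclotomic fields of coprime conductors are independent: an automorphism of `ℂ` can be
prescribed to be trivial on one and arbitrary on the other. -/
theorem IsPrimitiveRoot.exists_algEquiv_eq_self_and_eq_pow {m p e : ℕ} {ζ η : ℂ}
    (hζ : IsPrimitiveRoot ζ m) (hη : IsPrimitiveRoot η p) (hm : 0 < m) (hp : 0 < p)
    (hmp : m.Coprime p) (he : e.Coprime p) :
    ∃ σ : ℂ ≃ₐ[ℚ] ℂ, σ ζ = ζ ∧ σ η = η ^ e := by
  obtain ⟨f, hf1, hf2⟩ := Nat.chineseRemainder hmp 1 e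
  have hf : f.Coprime (m * p) := by
    refine Nat.Coprime.mul_right ?_ ?_
    · exact (Nat.ModEq.gcd_eq hf1).trans (by simp)
    · exact (Nat.ModEq.gcd_eq hf2).trans he
  have hprim : IsPrimitiveRoot (ζ * η) (m * p) := by
    have h := IsPrimitiveRoot.orderOf (ζ * η)
    rwa [(Commute.all ζ η).orderOf_mul_eq_mul_orderOf_of_coprime
      (by rwa [← hζ.eq_orderOf, ← hη.eq_orderOf]), ← hζ.eq_orderOf, ← hη.eq_orderOf] at h
  obtain ⟨σ, hσ⟩ := hprim.exists_algEquiv_eq_pow (Nat.mul_pos hm hp) hf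
  -- each of `ζ` and `η` is a power of `ζ * η`, so `σ` raises both to the power `f`
  have key : ∀ x : ℂ, x ^ (m * p) = 1 → σ x = x ^ f := by
    intro x hx
    have : NeZero (m * p) := ⟨(Nat.mul_pos hm hp).ne'⟩
    obtain ⟨k, -, rfl⟩ := hprim.eq_pow_of_pow_eq_one hx
    rw [map_pow, hσ, ← pow_mul, ← pow_mul, mul_comm f k]
  refine ⟨σ, ?_, ?_⟩
  · rw [key ζ (by rw [pow_mul, hζ.pow_eq_one, one_pow])]
    rw [← pow_mod_orderOf, ← hζ.eq_orderOf, hf1, hζ.eq_orderOf, pow_mod_orderOf, pow_one]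
  · rw [key η (by rw [mul_comm, pow_mul, hη.pow_eq_one, one_pow])]
    rw [← pow_mod_orderOf, ← hη.eq_orderOf, hf2, hη.eq_orderOf, pow_mod_orderOf]

/-! ### Kummer theory for two radicals -/

/-- Kummer theory: radicals in distinct classes modulo `Mˣ` are linearly independent over `M`.
The radical `α i` gives the character `σ ↦ σ (α i) / α i` of the automorphism group of `ℂ` over `M`,
and distinct characters are linearly independent. -/
theorem linearIndependent_complex_of_pow_mem {M : Type} [Field M] [Countable M] [Algebra M ℂ]
    {n : ℕ} (hn : 0 < n) {ζ : M} (hζ : IsPrimitiveRoot ζ n) {ι : Type} {α : ι → ℂ}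
    (h0 : ∀ i, α i ≠ 0) (hpow : ∀ i, α i ^ n ∈ (algebraMap M ℂ).range)
    (hne : ∀ i j, α i / α j ∈ (algebraMap M ℂ).range → i = j) : LinearIndependent M α := by
  have hroot : ∀ i (σ : ℂ ≃ₐ[M] ℂ), ∃ c : M, σ (α i) = algebraMap M ℂ c * α i := by
    intro i σ
    obtain ⟨d, hd⟩ := hpow i
    have h1 : (σ (α i) / α i) ^ n = 1 := by
      rw [div_pow, ← map_pow, ← hd, σ.commutes, hd, div_self (pow_ne_zero _ (h0 i))]
    have : NeZero n := ⟨hn.ne'⟩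
    obtain ⟨k, -, hk⟩ := (hζ.map_of_injective (algebraMap M ℂ).injective).eq_pow_of_pow_eq_one h1
    exact ⟨ζ ^ k, by rw [map_pow, hk, div_mul_cancel₀ _ (h0 i)]⟩
  let χ : ι → (ℂ ≃ₐ[M] ℂ) →* ℂ := fun i =>
    { toFun := fun σ => σ (α i) / α i
      map_one' := by simp [h0 i]
      map_mul' := fun σ τ => by
        obtain ⟨c, hc⟩ := hroot i τ
        obtain ⟨d, hd⟩ := hroot i σ
        have := h0 i
        rw [AlgEquiv.mul_apply, hc, map_mul, σ.commutes, hd]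
        field_simp }
  have hχ : ∀ i σ, χ i σ * α i = σ (α i) := fun i σ => div_mul_cancel₀ _ (h0 i)
  have hinj : Function.Injective χ := by
    intro i j hij
    obtain ⟨c, hc⟩ := hpow i
    obtain ⟨d, hd⟩ := hpow j
    refine hne i j (mem_range_algebraMap_of_forall_algEquiv_eq ?_ fun σ => ?_)
    · refine IsIntegral.of_pow hn ?_
      rw [div_pow, ← hc, ← hd, ← map_div₀]
      exact isIntegral_algebraMap
    · have h1 := hχ i σ
      have h2 := hχ j σ
      have h3 : σ (α j) ≠ 0 := by simpa using h0 j
      rw [map_div₀, div_eq_div_iff h3 (h0 j), ← h1, ← h2, hij]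
      ring
  have hli := (linearIndependent_monoidHom (ℂ ≃ₐ[M] ℂ) ℂ).comp χ hinj
  rw [linearIndependent_iff'] at hli ⊢
  intro s g hg i hi
  have h := hli s (fun i => algebraMap M ℂ (g i) * α i) (by
    ext σ
    have h := congrArg σ hg
    simp only [map_sum, map_zero] at h
    simp only [Finset.sum_apply, Pi.smul_apply, Function.comp, smul_eq_mul, Pi.zero_apply]
    rw [← h]
    refine Finset.sum_congr rfl fun k _ => ?_
    rw [Algebra.smul_def, map_mul, σ.commutes, ← hχ k σ]
    ring) i hi
  simpa [h0 i] using h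

theorem finrank_adjoin_simple_le_of_pow_mem {M : Type} [Field M] [Algebra M ℂ] {A : ℕ}
    (hA : 0 < A) {ρ : ℂ} (hρ : ρ ^ A ∈ (algebraMap M ℂ).range) :
    IsIntegral M ρ ∧ Module.finrank M (IntermediateField.adjoin M {ρ}) ≤ A := by
  obtain ⟨c, hc⟩ := hρ
  have hm : (Polynomial.X ^ A - Polynomial.C c : Polynomial M).Monic :=
    Polynomial.monic_X_pow_sub_C c hA.ne'
  have he : Polynomial.aeval ρ (Polynomial.X ^ A - Polynomial.C c : Polynomial M) = 0 := by
    simp [hc]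
  have hi : IsIntegral M ρ := ⟨_, hm, by simpa using he⟩
  refine ⟨hi, ?_⟩
  rw [IntermediateField.adjoin.finrank hi, ← Polynomial.natDegree_X_pow_sub_C (n := A) (r := c)]
  exact Polynomial.natDegree_le_of_dvd (minpoly.dvd _ _ he) hm.ne_zero

/-- If `ρ ^ a * κ ^ b` lies in `M` exactly when `A ∣ a` and `B ∣ b`, then the monomials
`ρ ^ a * κ ^ b` with `a < A` and `b < B` form a basis of `M(ρ, κ)`. -/
theorem finrank_adjoin_pair_eq_mul {M : Type} [Field M] [Countable M] [Algebra M ℂ]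
    {n A B : ℕ} (hn : 0 < n) {ζ : M} (hζ : IsPrimitiveRoot ζ n) {ρ κ : ℂ} (hρ0 : ρ ≠ 0)
    (hκ0 : κ ≠ 0) (hA : A ∣ n) (hB : B ∣ n) (hρ : ρ ^ A ∈ (algebraMap M ℂ).range)
    (hκ : κ ^ B ∈ (algebraMap M ℂ).range)
    (h : ∀ a b : ℤ, ρ ^ a * κ ^ b ∈ (algebraMap M ℂ).range → (A : ℤ) ∣ a ∧ (B : ℤ) ∣ b) :
    Module.finrank M (IntermediateField.adjoin M {ρ, κ}) = A * B := by
  obtain ⟨hρi, hρle⟩ := finrank_adjoin_simple_le_of_pow_mem (Nat.pos_of_dvd_of_pos hA hn) hρ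
  obtain ⟨hκi, hκle⟩ := finrank_adjoin_simple_le_of_pow_mem (Nat.pos_of_dvd_of_pos hB hn) hκ
  have hsup : IntermediateField.adjoin M {ρ, κ} =
      IntermediateField.adjoin M {ρ} ⊔ IntermediateField.adjoin M {κ} := by
    rw [← IntermediateField.adjoin_union, Set.singleton_union]
  have : FiniteDimensional M (IntermediateField.adjoin M {ρ}) :=
    IntermediateField.adjoin.finiteDimensional hρi
  have : FiniteDimensional M (IntermediateField.adjoin M {κ}) :=
    IntermediateField.adjoin.finiteDimensional hκi
  have : FiniteDimensional M (IntermediateField.adjoin M {ρ, κ}) := by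
    rw [hsup]; infer_instance
  refine le_antisymm ?_ ?_
  · rw [hsup]
    exact (IntermediateField.finrank_sup_le _ _).trans (Nat.mul_le_mul hρle hκle)
  · have hρm : ρ ∈ IntermediateField.adjoin M {ρ, κ} :=
      IntermediateField.subset_adjoin _ _ (by simp)
    have hκm : κ ∈ IntermediateField.adjoin M {ρ, κ} :=
      IntermediateField.subset_adjoin _ _ (by simp)
    let α : Fin A × Fin B → IntermediateField.adjoin M {ρ, κ} := fun x =>
      ⟨ρ ^ (x.1 : ℕ) * κ ^ (x.2 : ℕ), mul_mem (pow_mem hρm _) (pow_mem hκm _)⟩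
    have hli : LinearIndependent M (fun x => (α x : ℂ)) := by
      refine linearIndependent_complex_of_pow_mem hn hζ
        (fun x => mul_ne_zero (pow_ne_zero _ hρ0) (pow_ne_zero _ hκ0)) (fun x => ?_) ?_
      · obtain ⟨A', rfl⟩ := hA
        obtain ⟨B', hB'⟩ := hB
        have h1 : (α x : ℂ) ^ (A * A') =
            ((ρ ^ A) ^ A') ^ (x.1 : ℕ) * ((κ ^ B) ^ B') ^ (x.2 : ℕ) := by
          rw [← pow_mul ρ A, ← pow_mul κ B, ← hB', pow_right_comm ρ, pow_right_comm κ]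
          exact mul_pow _ _ _
        rw [h1]
        exact mul_mem (pow_mem (pow_mem hρ _) _) (pow_mem (pow_mem hκ _) _)
      · rintro ⟨a, b⟩ ⟨a', b'⟩ hab
        have h1 : ρ ^ ((a : ℤ) - (a' : ℤ)) * κ ^ ((b : ℤ) - (b' : ℤ)) =
            (α (a, b) : ℂ) / α (a', b') := by
          simp only [α]
          rw [zpow_sub₀ hρ0, zpow_sub₀ hκ0]
          simp only [zpow_natCast]
          rw [div_mul_div_comm]
        obtain ⟨h2, h3⟩ := h _ _ (h1 ▸ hab)
        have h4 := Int.eq_zero_of_abs_lt_dvd h2 (by have := a.2; have := a'.2; rw [abs_lt]; omega)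
        have h5 := Int.eq_zero_of_abs_lt_dvd h3 (by have := b.2; have := b'.2; rw [abs_lt]; omega)
        ext <;> simp only <;> omega
    have hli' : LinearIndependent M α :=
      LinearIndependent.of_comp (IntermediateField.adjoin M {ρ, κ}).val.toLinearMap hli
    simpa using hli'.fintype_card_le_finrank

open IntermediateField

theorem algHom_eq_of_mem_adjoin {S : Set ℂ} {σ τ : ℂ →ₐ[ℚ] ℂ} (h : ∀ x ∈ S, σ x = τ x) {y : ℂ}
    (hy : y ∈ adjoin ℚ S) : σ y = τ y := by
  induction hy using adjoin_induction with
  | mem x hx => exact h x hx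
  | algebraMap x => simp
  | add x y _ _ hx hy => rw [map_add, map_add, hx, hy]
  | inv x _ hx => rw [map_inv₀, map_inv₀, hx]
  | mul x y _ _ hx hy => rw [map_mul, map_mul, hx, hy]

theorem algEquiv_fixes_of_mem_adjoin {S : Set ℂ} (σ : ℂ ≃ₐ[ℚ] ℂ) (h : ∀ x ∈ S, σ x = x) {y : ℂ}
    (hy : y ∈ adjoin ℚ S) : σ y = y :=
  algHom_eq_of_mem_adjoin (σ := σ.toAlgHom) (τ := AlgHom.id ℚ ℂ) h hy

theorem IsPrimitiveRoot.mem_adjoin_of_pow_eq_one {N : ℕ} {ω x : ℂ} (hω : IsPrimitiveRoot ω N)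
    (hN : 0 < N) (hx : x ^ N = 1) : x ∈ adjoin ℚ {ω} := by
  have : NeZero N := ⟨hN.ne'⟩
  obtain ⟨k, -, rfl⟩ := hω.eq_pow_of_pow_eq_one hx
  exact pow_mem (mem_adjoin_simple_self ℚ ω) k

/-! ### Quadratic Gauss sums of conductor 5 and 11 -/

/-- The quadratic Gauss sum of conductor `5` at a primitive fifth root of unity `η`. -/
noncomputable def gaussFive (η : ℂ) : ℂ := η - η ^ 2 - η ^ 3 + η ^ 4

/-- The quadratic Gauss sum of conductor `11` at a primitive eleventh root of unity `η`. -/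
noncomputable def gaussEleven (η : ℂ) : ℂ :=
  η - η ^ 2 + η ^ 3 + η ^ 4 + η ^ 5 - η ^ 6 - η ^ 7 - η ^ 8 + η ^ 9 - η ^ 10

theorem gaussFive_sq {η : ℂ} (hη : IsPrimitiveRoot η 5) : gaussFive η ^ 2 = 5 := by
  have h := hη.geom_sum_eq_zero (by norm_num)
  simp only [Finset.sum_range_succ, Finset.sum_range_zero] at h
  unfold gaussFive
  linear_combination (-5 + 5 * η + η ^ 2 - 3 * η ^ 3 + η ^ 4) * h

theorem gaussEleven_sq {η : ℂ} (hη : IsPrimitiveRoot η 11) : gaussEleven η ^ 2 = -11 := by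
  have h := hη.geom_sum_eq_zero (by norm_num)
  simp only [Finset.sum_range_succ, Finset.sum_range_zero] at h
  unfold gaussEleven
  linear_combination (11 - 11 * η + η ^ 2 - 3 * η ^ 3 + 5 * η ^ 4 - 3 * η ^ 5 + η ^ 6 -
    3 * η ^ 7 + 5 * η ^ 8 - 3 * η ^ 9 + η ^ 10) * h

theorem gaussFive_mem {η : ℂ} {S : Set ℂ} (h : η ∈ adjoin ℚ S) : gaussFive η ∈ adjoin ℚ S :=
  add_mem (sub_mem (sub_mem h (pow_mem h 2)) (pow_mem h 3)) (pow_mem h 4)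

theorem gaussEleven_mem {η : ℂ} {S : Set ℂ} (h : η ∈ adjoin ℚ S) : gaussEleven η ∈ adjoin ℚ S := by
  have hp := fun k => pow_mem h k
  exact sub_mem (add_mem (sub_mem (sub_mem (sub_mem (add_mem (add_mem (add_mem (sub_mem h (hp 2))
    (hp 3)) (hp 4)) (hp 5)) (hp 6)) (hp 7)) (hp 8)) (hp 9)) (hp 10)

theorem algEquiv_gaussFive {η : ℂ} (hη : IsPrimitiveRoot η 5) {σ : ℂ ≃ₐ[ℚ] ℂ}
    (hσ : σ η = η ^ 2) : σ (gaussFive η) = -gaussFive η := by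
  have h5 := hη.pow_eq_one
  simp only [gaussFive, map_add, map_sub, map_pow, hσ]
  linear_combination (η ^ 3 - η) * h5

theorem algEquiv_gaussEleven {η : ℂ} (hη : IsPrimitiveRoot η 11) {σ : ℂ ≃ₐ[ℚ] ℂ}
    (hσ : σ η = η ^ 10) : σ (gaussEleven η) = -gaussEleven η := by
  have h : ∀ k ≤ 11, (η ^ 10) ^ k = η ^ (11 - k) := by
    intro k hk
    have h1 : (η ^ 10) ^ k * η ^ k = 1 := by
      rw [← mul_pow, ← pow_succ, hη.pow_eq_one, one_pow]
    have h2 : η ^ (11 - k) * η ^ k = 1 := by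
      rw [← pow_add, Nat.sub_add_cancel hk, hη.pow_eq_one]
    exact mul_right_cancel₀ (pow_ne_zero k (hη.ne_zero (by norm_num))) (h1.trans h2.symm)
  have h1 := h 1 (by norm_num)
  rw [pow_one] at h1
  simp only [gaussEleven, map_add, map_sub, map_pow, hσ]
  rw [h 2 (by norm_num), h 3 (by norm_num), h 4 (by norm_num), h 5 (by norm_num),
    h 6 (by norm_num), h 7 (by norm_num), h 8 (by norm_num), h 9 (by norm_num), h 10 (by norm_num)]
  ring

theorem sqrt_five_eq_or {η : ℂ} (hη : IsPrimitiveRoot η 5) :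
    (Real.sqrt 5 : ℂ) = gaussFive η ∨ (Real.sqrt 5 : ℂ) = -gaussFive η :=
  sq_eq_sq_iff_eq_or_eq_neg.1 (sqrt_five_sq_complex.trans (gaussFive_sq hη).symm)

theorem sqrt_five_mem_adjoin {N : ℕ} {ω : ℂ} (hω : IsPrimitiveRoot ω N) (hN : 0 < N)
    (h5 : 5 ∣ N) : (Real.sqrt 5 : ℂ) ∈ adjoin ℚ {ω} := by
  obtain ⟨k, rfl⟩ := h5
  have hη : IsPrimitiveRoot (ω ^ k) 5 := hω.pow hN (mul_comm _ _)
  have hm := gaussFive_mem (pow_mem (mem_adjoin_simple_self ℚ ω) k)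
  rcases sqrt_five_eq_or hη with h | h <;> rw [h]
  · exact hm
  · exact neg_mem hm

theorem exists_algEquiv_sqrt_five_eq_neg {n : ℕ} {ζ : ℂ} (hζ : IsPrimitiveRoot ζ n) (hn : 0 < n)
    (h5 : ¬ 5 ∣ n) : ∃ σ : ℂ ≃ₐ[ℚ] ℂ, σ ζ = ζ ∧ σ (Real.sqrt 5 : ℂ) = -(Real.sqrt 5 : ℂ) := by
  have hη := Complex.isPrimitiveRoot_exp 5 (by norm_num)
  obtain ⟨σ, h1, h2⟩ := hζ.exists_algEquiv_eq_self_and_eq_pow hη hn (by norm_num)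
    ((Nat.Prime.coprime_iff_not_dvd (by norm_num)).2 h5).symm (e := 2) (by norm_num)
  refine ⟨σ, h1, ?_⟩
  rcases sqrt_five_eq_or hη with h | h <;> rw [h]
  · exact algEquiv_gaussFive hη h2
  · rw [map_neg, algEquiv_gaussFive hη h2]

/-! ### The degree of the cyclotomic part -/

theorem finrank_adjoin_root_of_unity {n : ℕ} {ζ : ℂ} (hζ : IsPrimitiveRoot ζ n) (hn : 0 < n) :
    Module.finrank ℚ (adjoin ℚ {ζ}) = n.totient := by
  rw [adjoin.finrank ((hζ.isIntegral hn).tower_top), ← Polynomial.cyclotomic_eq_minpoly_rat hζ hn,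
    Polynomial.natDegree_cyclotomic]

/-- The degree of `ℚ(√5, ζ_n)`: it is `φ(n)` or `2 φ(n)` according to whether `5 ∣ n`. -/
theorem finrank_adjoin_sqrt_five_root_of_unity {n : ℕ} {ζ : ℂ} (hζ : IsPrimitiveRoot ζ n)
    (hn : 0 < n) : Module.finrank ℚ (adjoin ℚ {(Real.sqrt 5 : ℂ), ζ}) * (if 5 ∣ n then 2 else 1) =
      2 * n.totient := by
  split_ifs with h5
  · have h : adjoin ℚ {(Real.sqrt 5 : ℂ), ζ} = adjoin ℚ {ζ} := by
      refine le_antisymm (adjoin_le_iff.2 ?_) (adjoin.mono _ _ _ (by simp))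
      rintro x (rfl | rfl)
      · exact sqrt_five_mem_adjoin hζ hn h5
      · exact mem_adjoin_simple_self ℚ _
    rw [h, finrank_adjoin_root_of_unity hζ hn, mul_comm]
  · let M := adjoin ℚ {ζ}
    have h : adjoin ℚ {(Real.sqrt 5 : ℂ), ζ} =
        (adjoin M {(Real.sqrt 5 : ℂ)}).restrictScalars ℚ := by
      rw [Set.pair_comm]
      exact (congrArg _ Set.singleton_union.symm).trans (adjoin_adjoin_left ℚ {ζ} _).symm
    have hne : (Real.sqrt 5 : ℂ) ∉ M := by
      intro hmem
      obtain ⟨σ, h1, h2⟩ := exists_algEquiv_sqrt_five_eq_neg hζ hn h5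
      have h3 := algEquiv_fixes_of_mem_adjoin σ (by simpa using h1) hmem
      rw [h2, neg_eq_self] at h3
      simpa [h3] using sqrt_five_sq_complex
    obtain ⟨hint, hle⟩ := finrank_adjoin_simple_le_of_pow_mem (M := M) (A := 2) (by norm_num)
      (ρ := (Real.sqrt 5 : ℂ)) ⟨5, by rw [sqrt_five_sq_complex]; exact map_ofNat (algebraMap M ℂ) 5⟩
    have h1 : Module.finrank M (adjoin M {(Real.sqrt 5 : ℂ)}) ≠ 1 := by
      rw [Ne, finrank_adjoin_simple_eq_one_iff]
      intro hb
      obtain ⟨x, hx⟩ := mem_bot.1 hb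
      exact hne (hx ▸ x.2)
    have : FiniteDimensional M (adjoin M {(Real.sqrt 5 : ℂ)}) := adjoin.finiteDimensional hint
    have h0 : 0 < Module.finrank M (adjoin M {(Real.sqrt 5 : ℂ)}) := Module.finrank_pos
    have h2 : Module.finrank M (adjoin M {(Real.sqrt 5 : ℂ)}) = 2 := by omega
    rw [h, mul_one, ← finrank_adjoin_root_of_unity hζ hn, mul_comm, ← h2]
    exact (Module.finrank_mul_finrank ℚ M (adjoin M {(Real.sqrt 5 : ℂ)})).symm

/-! ### Conjugation on the real quadratic field -/

theorem algEquiv_sqrt_five (σ : ℂ ≃ₐ[ℚ] ℂ) :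
    σ (Real.sqrt 5 : ℂ) = (Real.sqrt 5 : ℂ) ∨ σ (Real.sqrt 5 : ℂ) = -(Real.sqrt 5 : ℂ) := by
  refine sq_eq_sq_iff_eq_or_eq_neg.1 ?_
  rw [← map_pow, sqrt_five_sq_complex, map_ofNat]

theorem algEquiv_goldenUnit_of_eq {σ : ℂ ≃ₐ[ℚ] ℂ} (h : σ (Real.sqrt 5 : ℂ) = (Real.sqrt 5 : ℂ)) :
    σ goldenUnit = goldenUnit := by
  simp [goldenUnit, h, map_ofNat σ 2]

theorem algEquiv_goldenUnit_of_neg {σ : ℂ ≃ₐ[ℚ] ℂ}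
    (h : σ (Real.sqrt 5 : ℂ) = -(Real.sqrt 5 : ℂ)) : σ goldenUnit = goldenUnitConj := by
  simp [goldenUnit, goldenUnitConj, h, sub_eq_add_neg, map_ofNat σ 2]

theorem algEquiv_goldenUnitConj_of_eq {σ : ℂ ≃ₐ[ℚ] ℂ}
    (h : σ (Real.sqrt 5 : ℂ) = (Real.sqrt 5 : ℂ)) : σ goldenUnitConj = goldenUnitConj := by
  simp [goldenUnitConj, h, map_ofNat σ 2]

theorem algEquiv_goldenUnitConj_of_neg {σ : ℂ ≃ₐ[ℚ] ℂ}
    (h : σ (Real.sqrt 5 : ℂ) = -(Real.sqrt 5 : ℂ)) : σ goldenUnitConj = goldenUnit := by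
  simp [goldenUnit, goldenUnitConj, h, map_ofNat σ 2]

theorem goldenUnit_ne_zero : goldenUnit ≠ 0 := by
  intro h
  simpa [h] using goldenUnit_mul_conj

theorem goldenUnitConj_eq : goldenUnitConj = -goldenUnit⁻¹ := by
  have := goldenUnit_ne_zero
  field_simp
  linear_combination goldenUnit_mul_conj

theorem primeEleven_ne_zero : primeEleven ≠ 0 := by
  intro h
  simpa [h] using primeEleven_mul_conj

theorem primeElevenConj_ne_zero : primeElevenConj ≠ 0 := by
  intro h
  simpa [h] using primeEleven_mul_conj

theorem rElt_ne_zero : rElt ≠ 0 := by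
  simp [rElt, goldenUnit_ne_zero]

theorem qElt_ne_zero : qElt ≠ 0 :=
  div_ne_zero primeEleven_ne_zero primeElevenConj_ne_zero

theorem algEquiv_rElt_of_eq {σ : ℂ ≃ₐ[ℚ] ℂ} (h : σ (Real.sqrt 5 : ℂ) = (Real.sqrt 5 : ℂ)) :
    σ rElt = rElt := by
  simp [rElt, algEquiv_goldenUnit_of_eq h]

theorem algEquiv_rElt_of_neg {σ : ℂ ≃ₐ[ℚ] ℂ} (h : σ (Real.sqrt 5 : ℂ) = -(Real.sqrt 5 : ℂ)) :
    σ rElt = rElt⁻¹ := by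
  rw [← goldenUnit_div_conj, map_div₀, algEquiv_goldenUnit_of_neg h,
    algEquiv_goldenUnitConj_of_neg h, inv_div]

theorem algEquiv_qElt_of_eq {σ : ℂ ≃ₐ[ℚ] ℂ} (h : σ (Real.sqrt 5 : ℂ) = (Real.sqrt 5 : ℂ)) :
    σ qElt = qElt := by
  simp [qElt, primeEleven, primeElevenConj, map_ofNat σ 3,
    algEquiv_goldenUnit_of_eq h, algEquiv_goldenUnitConj_of_eq h]

theorem algEquiv_qElt_of_neg {σ : ℂ ≃ₐ[ℚ] ℂ} (h : σ (Real.sqrt 5 : ℂ) = -(Real.sqrt 5 : ℂ)) :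
    σ qElt = qElt⁻¹ := by
  simp [qElt, primeEleven, primeElevenConj, map_ofNat σ 3,
    algEquiv_goldenUnit_of_neg h, algEquiv_goldenUnitConj_of_neg h]

theorem sqrt_five_mem_quadField : (Real.sqrt 5 : ℂ) ∈ quadField :=
  mem_adjoin_simple_self ℚ _

theorem goldenUnit_mem_quadField : goldenUnit ∈ quadField :=
  div_mem (add_mem (one_mem _) sqrt_five_mem_quadField) (ofNat_mem _ 2)

theorem goldenUnitConj_mem_quadField : goldenUnitConj ∈ quadField :=
  div_mem (sub_mem (one_mem _) sqrt_five_mem_quadField) (ofNat_mem _ 2)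

theorem qElt_mem_quadField : qElt ∈ quadField :=
  div_mem (sub_mem (one_mem _) (mul_mem (ofNat_mem _ 3) goldenUnit_mem_quadField))
    (sub_mem (one_mem _) (mul_mem (ofNat_mem _ 3) goldenUnitConj_mem_quadField))

theorem rElt_mem_quadField : rElt ∈ quadField :=
  neg_mem (pow_mem goldenUnit_mem_quadField 2)

theorem goldenUnit_eq_goldenRatio : goldenUnit = (Real.goldenRatio : ℂ) := by
  simp [goldenUnit, Real.goldenRatio]

theorem exists_real_eq_qElt : ∃ t : ℝ, t < 0 ∧ qElt = (t : ℂ) := by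
  have h5 : Real.sqrt 5 ^ 2 = 5 := Real.sq_sqrt (by norm_num)
  have h0 := Real.sqrt_nonneg 5
  refine ⟨(1 - 3 * ((1 + Real.sqrt 5) / 2)) / (1 - 3 * ((1 - Real.sqrt 5) / 2)), ?_, ?_⟩
  · refine div_neg_of_neg_of_pos ?_ ?_ <;> nlinarith
  · simp [qElt, primeEleven, primeElevenConj, goldenUnit, goldenUnitConj]

/-! ### Units of norm 1 -/

theorem isIntegral_sqrt_five : IsIntegral ℚ (Real.sqrt 5 : ℂ) :=
  IsIntegral.of_pow (n := 2) (by norm_num) (by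
    rw [sqrt_five_sq_complex]
    simpa using isIntegral_algebraMap (R := ℚ) (A := ℂ) (x := 5))

theorem isIntegral_goldenUnit : IsIntegral ℤ goldenUnit := by
  refine ⟨Polynomial.X ^ 2 - Polynomial.X - 1, by monicity!, ?_⟩
  simp only [goldenUnit, Polynomial.eval₂_sub, Polynomial.eval₂_X_pow, Polynomial.eval₂_X,
    Polynomial.eval₂_one]
  linear_combination (1 / 4 : ℂ) * sqrt_five_sq_complex

theorem isIntegral_goldenUnit_zpow (k : ℤ) : IsIntegral ℤ (goldenUnit ^ k) := by
  have hinv : IsIntegral ℤ goldenUnit⁻¹ := by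
    have h : goldenUnit⁻¹ = goldenUnit - 1 := by
      rw [← neg_eq_iff_eq_neg.2 goldenUnitConj_eq, goldenUnit, goldenUnitConj]
      ring
    rw [h]
    exact isIntegral_goldenUnit.sub isIntegral_one
  cases k with
  | ofNat k => simpa using isIntegral_goldenUnit.pow k
  | negSucc k =>
    rw [zpow_negSucc, ← inv_pow]
    exact hinv.pow _

instance countable_quadField : Countable quadField := by
  have : Algebra.IsAlgebraic ℚ quadField := isAlgebraic_adjoin (by simpa using isIntegral_sqrt_five)
  exact countable_of_isAlgebraic ℚ _

/-- A positive unit `u` of norm `1` in `ℚ(√5)` is an even power of `ε`. After division by an even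
power of `ε` it lies in `[1, ε²)`, and then its trace `t + t⁻¹` is an integer in `[2, 3)`, so that
`t = 1`. That `u` is a unit is encoded by `u ^ n` being a power of `ε`. -/
theorem exists_eq_goldenUnit_zpow {u : ℂ} (huK : u ∈ quadField) {m : ℝ} (hm : 0 < m)
    (hum : u = (m : ℂ)) {τ : ℂ ≃ₐ[ℚ] ℂ} (hτ : τ (Real.sqrt 5 : ℂ) = -(Real.sqrt 5 : ℂ))
    (hu : τ u = u⁻¹) {n : ℕ} (hn : 0 < n) {c : ℤ} (hc : u ^ n = goldenUnit ^ c) :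
    ∃ k : ℤ, u = goldenUnit ^ (2 * k) := by
  have hφ := Real.one_lt_goldenRatio
  have hφ2 := Real.goldenRatio_sq
  obtain ⟨k, hk1, hk2⟩ := exists_mem_Ico_zpow hm (show 1 < Real.goldenRatio ^ 2 by nlinarith)
  refine ⟨k, ?_⟩
  have hP : (0 : ℝ) < (Real.goldenRatio ^ 2) ^ k := by positivity
  set t : ℝ := m / (Real.goldenRatio ^ 2) ^ k with ht
  have ht1 : 1 ≤ t := by rwa [ht, one_le_div hP]
  have ht2 : t < Real.goldenRatio ^ 2 := by
    rwa [ht, div_lt_iff₀ hP, ← zpow_one_add₀ (by positivity), add_comm]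
  have htv : (t : ℂ) = u / goldenUnit ^ (2 * k) := by
    rw [ht, hum, goldenUnit_eq_goldenRatio, zpow_mul]
    push_cast
    norm_cast
  have hg := goldenUnit_ne_zero
  have hτt : τ (t : ℂ) = (t : ℂ)⁻¹ := by
    rw [htv, map_div₀, hu, map_zpow₀, algEquiv_goldenUnit_of_neg hτ, goldenUnitConj_eq, zpow_mul,
      zpow_mul]
    norm_num
    rw [div_eq_mul_inv, mul_comm]
  have hint : ∀ e : ℤ, IsIntegral ℤ ((t : ℂ) ^ e) := by
    intro e
    refine IsIntegral.of_pow hn ?_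
    have h : ((t : ℂ) ^ e) ^ n = goldenUnit ^ ((c - 2 * k * n) * e) := by
      rw [← zpow_natCast, zpow_comm, zpow_natCast, htv, div_pow, hc, ← zpow_natCast, ← zpow_mul,
        ← zpow_sub₀ hg, ← zpow_mul]
    rw [h]
    exact isIntegral_goldenUnit_zpow _
  have hs : IsIntegral ℤ ((t : ℂ) + (t : ℂ)⁻¹) := by
    simpa using (hint 1).add (hint (-1))
  have htK : (t : ℂ) ∈ quadField := by
    rw [htv]
    exact div_mem huK (zpow_mem goldenUnit_mem_quadField _)
  have hrat : (t : ℂ) + (t : ℂ)⁻¹ ∈ (algebraMap ℚ ℂ).range := by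
    refine mem_range_algebraMap_of_forall_algEquiv_eq hs.tower_top fun σ => ?_
    rcases algEquiv_sqrt_five σ with h | h
    · rw [map_add, map_inv₀, algEquiv_fixes_of_mem_adjoin σ (by simpa using h) htK]
    · have h1 : σ (t : ℂ) = (t : ℂ)⁻¹ := by
        rw [← hτt]
        exact algHom_eq_of_mem_adjoin (σ := σ.toAlgHom) (τ := τ.toAlgHom)
          (by simpa [hτ] using h) htK
      rw [map_add, map_inv₀, h1, inv_inv, add_comm]
  obtain ⟨x, hx⟩ := hrat
  obtain ⟨N, hN⟩ := hs.exists_int_iff_exists_rat.1 ⟨x, hx.symm⟩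
  have hN' : t + t⁻¹ = (N : ℝ) := by exact_mod_cast hN
  have ht0 : 0 < t := by linarith
  have hN2 : t ^ 2 + 1 = N * t := by
    rw [← hN']
    field_simp
  -- `t + t⁻¹` is an integer in the interval `[2, 3)`
  have hlt : (N : ℝ) < 3 := by
    by_contra hge
    have h1 : (t - 1) * (Real.goldenRatio ^ 2 - t) ≥ 0 :=
      mul_nonneg (by linarith) (by linarith)
    nlinarith
  have hge : (2 : ℝ) ≤ N := by nlinarith [sq_nonneg (t - 1)]
  have hNeq : N = 2 := by
    have h1 : N < 3 := by exact_mod_cast hlt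
    have h2 : 2 ≤ N := by exact_mod_cast hge
    omega
  have ht1' : t = 1 := by
    rw [hNeq] at hN2
    push_cast at hN2
    have : (t - 1) ^ 2 = 0 := by linear_combination hN2
    have := pow_eq_zero_iff (two_ne_zero) |>.1 this
    linarith
  rw [ht1', Complex.ofReal_one, eq_comm, div_eq_one_iff_eq (zpow_ne_zero _ hg)] at htv
  exact htv

/-! ### Valuation at the prime above 11 -/

/-- The polynomial `X² - X - 1` has the simple root `4` modulo `11`. -/
theorem exists_padicInt_sq_eq_add_one [Fact (Nat.Prime 11)] :
    ∃ e : ℤ_[11], e ^ 2 = e + 1 := by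
  have h11 : ‖(11 : ℤ_[11])‖ < 1 := by
    simpa using (PadicInt.norm_int_lt_one_iff_dvd (p := 11) 11).2 (by norm_num)
  have h7 : ‖(7 : ℤ_[11])‖ = 1 := by
    refine le_antisymm (PadicInt.norm_le_one _) (not_lt.1 fun h => ?_)
    have := (PadicInt.norm_int_lt_one_iff_dvd (p := 11) 7).1 (by simpa using h)
    norm_num at this
  obtain ⟨e, he, -⟩ := hensels_lemma (p := 11) (R := ℤ)
    (F := Polynomial.X ^ 2 - Polynomial.X - 1) (a := (4 : ℤ_[11])) (by
      simp only [map_sub, map_pow, Polynomial.aeval_X, map_one,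
        Polynomial.derivative_X_pow, Polynomial.derivative_X, Polynomial.derivative_one, map_mul,
        map_natCast]
      norm_num [h11, h7])
  simp only [map_sub, map_pow, Polynomial.aeval_X, map_one] at he
  exact ⟨e, by linear_combination he⟩

theorem minpoly_sqrt_five :
    minpoly ℚ (Real.sqrt 5 : ℂ) = Polynomial.X ^ 2 - Polynomial.C 5 := by
  have hirr : Irreducible (Polynomial.X ^ 2 - Polynomial.C 5 : Polynomial ℚ) := by
    refine X_pow_sub_C_irreducible_of_prime Nat.prime_two fun b hb => ?_
    refine Nat.prime_five.irrational_sqrt ⟨|b|, ?_⟩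
    have h : ((b : ℝ)) ^ 2 = (5 : ℕ) := by exact_mod_cast hb
    rw [← h, Real.sqrt_sq_eq_abs]
    push_cast
    rfl
  refine (minpoly.eq_of_irreducible_of_monic hirr ?_
    (Polynomial.monic_X_pow_sub_C _ two_ne_zero)).symm
  simp [sqrt_five_sq_complex]

theorem exists_algHom_padic [Fact (Nat.Prime 11)] :
    ∃ (f : quadField →ₐ[ℚ] ℚ_[11]) (e : ℤ_[11]), e ^ 2 = e + 1 ∧
      f ⟨goldenUnit, goldenUnit_mem_quadField⟩ = e ∧
      f ⟨goldenUnitConj, goldenUnitConj_mem_quadField⟩ = ((1 - e : ℤ_[11]) : ℚ_[11]) := by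
  obtain ⟨e, he⟩ := exists_padicInt_sq_eq_add_one
  have he' : (e : ℚ_[11]) ^ 2 = e + 1 := by exact_mod_cast congrArg ((↑) : ℤ_[11] → ℚ_[11]) he
  let f : quadField →ₐ[ℚ] ℚ_[11] := (algHomAdjoinIntegralEquiv ℚ isIntegral_sqrt_five).symm
    ⟨2 * e - 1, by
      rw [Polynomial.mem_aroots, minpoly_sqrt_five]
      refine ⟨(Polynomial.monic_X_pow_sub_C _ two_ne_zero).ne_zero, ?_⟩
      simp only [map_sub, map_pow, Polynomial.aeval_X, map_ofNat]
      linear_combination 4 * he'⟩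
  have hf : f ⟨(Real.sqrt 5 : ℂ), sqrt_five_mem_quadField⟩ = 2 * e - 1 :=
    algHomAdjoinIntegralEquiv_symm_apply_gen ℚ isIntegral_sqrt_five _
  have h1 : (⟨goldenUnit, goldenUnit_mem_quadField⟩ : quadField) =
      (1 + ⟨(Real.sqrt 5 : ℂ), sqrt_five_mem_quadField⟩) / 2 := rfl
  have h2 : (⟨goldenUnitConj, goldenUnitConj_mem_quadField⟩ : quadField) =
      (1 - ⟨(Real.sqrt 5 : ℂ), sqrt_five_mem_quadField⟩) / 2 := rfl
  refine ⟨f, e, he, ?_, ?_⟩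
  · rw [h1, map_div₀, map_add, hf, map_one, map_ofNat]
    ring
  · rw [h2, map_div₀, map_sub, hf, map_one, map_ofNat]
    push_cast
    ring

/-- The element `q` generates the value group at `π₁₁`, where `ε` is a unit. The valuation is read
off in `ℚ₁₁`, into which `ℚ(√5)` embeds. -/
theorem dvd_of_pow_eq_goldenUnit_zpow_mul_qElt_zpow {w : ℂ} (hw : w ∈ quadField) {n : ℕ}
    {c d : ℤ} (h : w ^ n = goldenUnit ^ c * qElt ^ d) : (n : ℤ) ∣ d := by
  have : Fact (Nat.Prime 11) := ⟨by norm_num⟩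
  obtain ⟨f, e, he, hf1, hf2⟩ := exists_algHom_padic
  have hK : (⟨w, hw⟩ : quadField) ^ n = ⟨goldenUnit, goldenUnit_mem_quadField⟩ ^ c *
      ((1 - 3 * ⟨goldenUnit, goldenUnit_mem_quadField⟩) /
        (1 - 3 * ⟨goldenUnitConj, goldenUnitConj_mem_quadField⟩)) ^ d :=
    Subtype.ext h
  have hfK := congrArg (fun x => ‖f x‖) hK
  simp only [map_pow, map_mul, map_zpow₀, map_div₀, map_sub, map_one, map_ofNat, hf1, hf2,
    norm_pow, norm_mul, norm_zpow, norm_div] at hfK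
  have hπ : (1 - 3 * (e : ℚ_[11])) = ((1 - 3 * e : ℤ_[11]) : ℚ_[11]) := by push_cast; rfl
  have hπ' : (1 - 3 * ((1 - e : ℤ_[11]) : ℚ_[11])) =
      ((1 - 3 * (1 - e) : ℤ_[11]) : ℚ_[11]) := by push_cast; rfl
  rw [hπ, hπ'] at hfK
  simp only [← PadicInt.norm_def] at hfK
  have he1 : ‖e‖ = 1 := by
    refine PadicInt.isUnit_iff.1 (IsUnit.of_mul_eq_one (e - 1) ?_)
    linear_combination he
  -- the images of `π₁₁` and its conjugate have product `-11` and sum `-1`: one of them is a unit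
  -- and the other a uniformizer
  have hprod : ‖1 - 3 * e‖ * ‖1 - 3 * (1 - e)‖ = 11⁻¹ := by
    rw [← norm_mul]
    have h1 : (1 - 3 * e) * (1 - 3 * (1 - e)) = -((11 : ℕ) : ℤ_[11]) := by
      push_cast
      linear_combination (-9 : ℤ_[11]) * he
    rw [h1, norm_neg, PadicInt.norm_p]
    norm_num
  have hquot : ∃ k : ℤ, (k = 1 ∨ k = -1) ∧
      ‖1 - 3 * e‖ / ‖1 - 3 * (1 - e)‖ = (11 : ℝ) ^ k := by
    have hsum : (1 - 3 * e) + (1 - 3 * (1 - e)) = -1 := by ring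
    rcases eq_or_lt_of_le (PadicInt.norm_le_one (1 - 3 * e)) with h1 | h1
    · refine ⟨1, Or.inl rfl, ?_⟩
      rw [h1, one_mul] at hprod
      rw [h1, hprod]
      norm_num
    · have h2 : ‖1 - 3 * (1 - e)‖ = 1 := by
        refine le_antisymm (PadicInt.norm_le_one _) (not_lt.1 fun h2 => ?_)
        have h3 := (PadicInt.nonarchimedean (1 - 3 * e) (1 - 3 * (1 - e))).trans_lt
          (max_lt h1 h2)
        rw [hsum, norm_neg, norm_one] at h3
        exact lt_irrefl _ h3
      refine ⟨-1, Or.inr rfl, ?_⟩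
      rw [h2, mul_one] at hprod
      rw [h2, hprod]
      norm_num
  obtain ⟨k, hk, hk'⟩ := hquot
  rw [hk', he1, one_zpow, one_mul] at hfK
  by_cases hw0 : f ⟨w, hw⟩ = 0
  · rcases Nat.eq_zero_or_pos n with rfl | hn
    · rw [pow_zero, ← zpow_mul] at hfK
      have h0 := zpow_right_injective₀ (a := (11 : ℝ)) (by norm_num) (by norm_num)
        ((zpow_zero (11 : ℝ)).trans hfK)
      rcases hk with rfl | rfl <;> simp at h0 <;> simp [h0]
    · rw [hw0, norm_zero, zero_pow hn.ne'] at hfK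
      exact absurd hfK.symm (zpow_ne_zero _ (zpow_ne_zero _ (by norm_num)))
  · rw [Padic.norm_eq_zpow_neg_valuation hw0, ← zpow_natCast, ← zpow_mul, ← zpow_mul] at hfK
    have h0 := zpow_right_injective₀ (a := (11 : ℝ)) (by norm_num) (by norm_num) hfK
    rcases hk with rfl | rfl
    · exact ⟨-(f ⟨w, hw⟩).valuation, by linear_combination -h0⟩
    · exact ⟨(f ⟨w, hw⟩).valuation, by linear_combination h0⟩

/-! ### Monomials in the radicals that are cyclotomic -/

/-- Complex conjugation commutes with every automorphism on a cyclotomic field. -/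
theorem conj_algEquiv_of_mem_adjoin {N : ℕ} {ω : ℂ} (hω : IsPrimitiveRoot ω N) (hN : 0 < N)
    (σ : ℂ ≃ₐ[ℚ] ℂ) {y : ℂ} (hy : y ∈ adjoin ℚ {ω}) :
    starRingEnd ℂ (σ y) = σ (starRingEnd ℂ y) := by
  let c : ℂ →ₐ[ℚ] ℂ := Complex.conjAe.toAlgHom.restrictScalars ℚ
  refine algHom_eq_of_mem_adjoin (σ := c.comp σ.toAlgHom) (τ := σ.toAlgHom.comp c) ?_ hy
  rintro x rfl
  have h1 : ‖σ x‖ = 1 := (hω.map_of_injective σ.injective).norm'_eq_one hN.ne'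
  have h2 : ‖x‖ = 1 := hω.norm'_eq_one hN.ne'
  change starRingEnd ℂ (σ x) = σ (starRingEnd ℂ x)
  rw [← Complex.inv_eq_conj h1, ← Complex.inv_eq_conj h2, map_inv₀]

/-- A monomial `y = ρ ^ a * κ ^ b` in `ℚ(√5, ζ_n)` has its square in `ℚ(√5)`, up to roots of unity;
in terms of exponents, `n ∣ 2a` and `i ∣ 2b`. All conjugates of `|y|` are real because `|y|` lies in
a cyclotomic field, so `|y|²` lies in `ℚ(√5)`, where it has norm `1` as `r` and `q` do. -/
theorem two_mul_dvd_of_mem {i j : ℕ} (hi : 1 ≤ i) (hj : 1 ≤ j) {ζ ρ κ : ℂ}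
    (hζ : IsPrimitiveRoot ζ (i * j)) (hρ : ρ ^ (i * j) = rElt) (hκ : κ ^ i = qElt) {a b : ℤ}
    (hy : ρ ^ a * κ ^ b ∈ adjoin ℚ {(Real.sqrt 5 : ℂ), ζ}) :
    ((i * j : ℕ) : ℤ) ∣ 2 * a ∧ (i : ℤ) ∣ 2 * b := by
  set n := i * j with hn
  have hn0 : 0 < n := Nat.mul_pos hi hj
  set y := ρ ^ a * κ ^ b with hydef
  set x := rElt ^ a * qElt ^ (j * b) with hx
  obtain ⟨t, ht0, ht⟩ := exists_real_eq_qElt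
  have hx0 : x ≠ 0 := mul_ne_zero (zpow_ne_zero _ rElt_ne_zero) (zpow_ne_zero _ qElt_ne_zero)
  have hyn : y ^ n = x := by
    rw [hydef, hx, mul_pow, ← zpow_natCast, zpow_comm, zpow_natCast, hρ, ← zpow_natCast,
      ← zpow_mul, hn, ← hκ, ← zpow_natCast, ← zpow_mul]
    congr 2
    push_cast
    ring
  have hy0 : y ≠ 0 := by
    intro h
    rw [h, zero_pow hn0.ne'] at hyn
    exact hx0 hyn.symm
  have hxreal : starRingEnd ℂ x = x := by
    have hr : starRingEnd ℂ rElt = rElt := by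
      rw [rElt, goldenUnit_eq_goldenRatio, map_neg, map_pow, Complex.conj_ofReal]
    have hq : starRingEnd ℂ qElt = qElt := by rw [ht, Complex.conj_ofReal]
    rw [hx, map_mul, map_zpow₀, map_zpow₀, hr, hq]
  -- the absolute value `Y` of `y` is again a cyclotomic number, because `y / Y` is a root of unity
  set Y : ℂ := (‖y‖ : ℂ) with hY
  have hYn : Y ^ (2 * n) = x ^ 2 := by
    rw [hY, mul_comm, pow_mul, ← Complex.ofReal_pow, ← norm_pow, hyn, ← Complex.mul_conj',
      hxreal, sq]
  have hω := Complex.isPrimitiveRoot_exp (10 * n) (by positivity)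
  set ω := Complex.exp (2 * Real.pi * Complex.I / ((10 * n : ℕ) : ℂ))
  have hN0 : 0 < 10 * n := by positivity
  have hyω : y ∈ adjoin ℚ {ω} := by
    refine adjoin_le_iff.2 ?_ hy
    rintro z (rfl | rfl)
    · exact sqrt_five_mem_adjoin hω hN0 ⟨2 * n, by ring⟩
    · exact hω.mem_adjoin_of_pow_eq_one hN0 (by
        rw [mul_comm, pow_mul, hζ.pow_eq_one, one_pow])
  have hYω : Y ∈ adjoin ℚ {ω} := by
    have h1 : Y / y ∈ adjoin ℚ {ω} := by
      refine hω.mem_adjoin_of_pow_eq_one hN0 ?_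
      have h2 : 10 * n = 2 * n * 5 := by ring
      rw [h2, pow_mul, div_pow, hYn, mul_comm 2 n, pow_mul, hyn, div_self (pow_ne_zero _ hx0),
        one_pow]
    simpa [hy0] using mul_mem h1 hyω
  have hYreal : ∀ σ : ℂ ≃ₐ[ℚ] ℂ, ∃ v : ℝ, σ Y = (v : ℂ) := by
    intro σ
    refine Complex.conj_eq_iff_real.1 ?_
    rw [conj_algEquiv_of_mem_adjoin hω hN0 σ hYω, hY, Complex.conj_ofReal]
  -- real numbers with equal `2n`-th powers have equal squares
  have hreal : ∀ v v' : ℝ, (v : ℂ) ^ (2 * n) = (v' : ℂ) ^ (2 * n) →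
      (v : ℂ) ^ 2 = (v' : ℂ) ^ 2 := by
    intro v v' h
    have h1 : (v ^ 2) ^ n = (v' ^ 2) ^ n := by
      rw [← pow_mul, ← pow_mul]
      exact_mod_cast h
    have h2 := (pow_left_inj₀ (sq_nonneg v) (sq_nonneg v') hn0.ne').1 h1
    exact_mod_cast h2
  have hσpos : ∀ σ : ℂ ≃ₐ[ℚ] ℂ, σ (Real.sqrt 5 : ℂ) = (Real.sqrt 5 : ℂ) →
      σ (Y ^ 2) = Y ^ 2 := by
    intro σ hσ
    obtain ⟨v, hv⟩ := hYreal σ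
    rw [map_pow, hv, hY]
    refine hreal _ _ ?_
    rw [← hv, ← map_pow, ← hY, hYn, hx]
    simp [algEquiv_rElt_of_eq hσ, algEquiv_qElt_of_eq hσ]
  have hσneg : ∀ σ : ℂ ≃ₐ[ℚ] ℂ, σ (Real.sqrt 5 : ℂ) = -(Real.sqrt 5 : ℂ) →
      σ (Y ^ 2) = (Y ^ 2)⁻¹ := by
    intro σ hσ
    obtain ⟨v, hv⟩ := hYreal σ
    rw [map_pow, hv, hY, ← inv_pow, ← Complex.ofReal_inv]
    refine hreal _ _ ?_
    rw [← hv, ← map_pow, Complex.ofReal_inv, inv_pow, ← hY, hYn, hx]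
    rw [map_pow, map_mul, map_zpow₀, map_zpow₀, algEquiv_rElt_of_neg hσ, algEquiv_qElt_of_neg hσ,
      inv_zpow, inv_zpow, ← mul_inv, inv_pow]
  have hYnK : (Y ^ 2) ^ n = goldenUnit ^ (4 * a) * qElt ^ (2 * j * b) := by
    have h4 : goldenUnit ^ (4 * a) = rElt ^ (2 * a) := by
      rw [zpow_mul, zpow_mul, rElt]
      congr 1
      norm_cast
      ring
    rw [← pow_mul, hYn, hx, mul_pow, h4, ← zpow_natCast, ← zpow_natCast, ← zpow_mul, ← zpow_mul]
    congr 2 <;> push_cast <;> ring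
  have hYK : Y ^ 2 ∈ quadField := by
    have hmem : (Y ^ 2) ^ n ∈ quadField := by
      rw [hYnK]
      exact mul_mem (zpow_mem goldenUnit_mem_quadField _) (zpow_mem qElt_mem_quadField _)
    have hint : IsIntegral quadField (Y ^ 2) := by
      refine IsIntegral.of_pow hn0 ?_
      exact isIntegral_algebraMap (x := (⟨(Y ^ 2) ^ n, hmem⟩ : quadField))
    obtain ⟨z, hz⟩ := mem_range_algebraMap_of_forall_algEquiv_eq hint fun σ =>
      hσpos (σ.restrictScalars ℚ) (σ.commutes ⟨_, sqrt_five_mem_quadField⟩)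
    exact hz ▸ z.2
  -- hence `2b / i` is an integer `B`, by comparing valuations at `π₁₁`; dividing `Y ^ 2` by
  -- `(-q) ^ B` (positive, since `q < 0`) leaves a unit
  obtain ⟨B, hB⟩ := dvd_of_pow_eq_goldenUnit_zpow_mul_qElt_zpow hYK hYnK
  have hj0 : (j : ℤ) ≠ 0 := by exact_mod_cast (show j ≠ 0 by omega)
  have hBi : 2 * b = i * B := by
    refine mul_left_cancel₀ hj0 ?_
    rw [hn] at hB
    push_cast at hB
    linear_combination hB
  obtain ⟨τ, -, hτ⟩ := exists_algEquiv_sqrt_five_eq_neg IsPrimitiveRoot.one one_pos (by norm_num)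
  have hun : (Y ^ 2 * (-qElt) ^ (-B)) ^ n = goldenUnit ^ (4 * a) := by
    have h1 : ((-qElt) ^ (-B)) ^ n = qElt ^ (-(2 * j * b)) := by
      rw [← zpow_natCast, ← zpow_mul]
      have h2 : -B * (n : ℤ) = 2 * (-(j * b)) := by linear_combination hB
      have h3 : -(2 * j * b) = 2 * (-(j * b)) := by ring
      rw [h2, h3, zpow_mul, zpow_mul]
      norm_num
    rw [mul_pow, hYnK, h1, mul_assoc, ← zpow_add₀ qElt_ne_zero, add_neg_cancel, zpow_zero,
      mul_one]
  obtain ⟨k, hk⟩ := exists_eq_goldenUnit_zpow (u := Y ^ 2 * (-qElt) ^ (-B))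
    (mul_mem hYK (zpow_mem (neg_mem qElt_mem_quadField) _)) (m := ‖y‖ ^ 2 * (-t) ^ (-B))
    (mul_pos (pow_pos (norm_pos_iff.2 hy0) 2) (zpow_pos (neg_pos.2 ht0) _))
    (by rw [hY, ht]; push_cast; rfl) hτ
    (by
      rw [map_mul, hσneg τ hτ, map_zpow₀, map_neg, algEquiv_qElt_of_neg hτ, mul_inv, ← inv_neg,
        inv_zpow]) hn0 hun
  refine ⟨⟨k, ?_⟩, ⟨B, hBi⟩⟩
  rw [hk, ← zpow_natCast, ← zpow_mul, goldenUnit_eq_goldenRatio] at hun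
  have h1 : Real.goldenRatio ^ (2 * k * (n : ℤ)) = Real.goldenRatio ^ (4 * a) := by
    exact_mod_cast hun
  have h2 := zpow_right_injective₀ (by positivity) Real.one_lt_goldenRatio.ne' h1
  linarith

/-! ### The entanglement of the square roots of r and q -/

theorem rElt_eq_sq : rElt = (Complex.I * goldenUnit) ^ 2 := by
  rw [rElt, mul_pow, Complex.I_sq, neg_one_mul]

theorem qElt_eq_sq {η : ℂ} (hη : IsPrimitiveRoot η 11) :
    qElt = (gaussEleven η / primeElevenConj) ^ 2 := by
  have h := primeElevenConj_ne_zero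
  rw [div_pow, gaussEleven_sq hη, qElt, ← primeEleven_mul_conj]
  field_simp

theorem not_mem_of_algEquiv_eq_neg {S : Set ℂ} (σ : ℂ ≃ₐ[ℚ] ℂ) (hσ : ∀ x ∈ S, σ x = x) {z : ℂ}
    (hz : σ z = -z) (h0 : z ≠ 0) : z ∉ adjoin ℚ S := by
  intro h
  have h1 := algEquiv_fixes_of_mem_adjoin σ hσ h
  rw [hz, neg_eq_self] at h1
  exact h0 h1

/-- If `11 ∤ n`, some automorphism fixes `i`, `√5` and `ζ_n` but changes the sign of `√-11`. -/
theorem eleven_dvd_of_mem {n : ℕ} (hn : 0 < n) {ζ η : ℂ} (hζ : IsPrimitiveRoot ζ n)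
    (hη : IsPrimitiveRoot η 11) {a b : ℤ} (hb : Odd b)
    (h : Complex.I ^ a * gaussEleven η ^ b ∈ adjoin ℚ {(Real.sqrt 5 : ℂ), ζ}) : 11 ∣ n := by
  by_contra h11
  have hN : 0 < 20 * n := by positivity
  have hω := Complex.isPrimitiveRoot_exp (20 * n) hN.ne'
  obtain ⟨σ, h1, h2⟩ := hω.exists_algEquiv_eq_self_and_eq_pow hη hN (by norm_num)
    (e := 10) (by
      refine ((Nat.Prime.coprime_iff_not_dvd (by norm_num)).2 fun h => ?_).symm
      rcases (Nat.Prime.dvd_mul (by norm_num)).1 h with h | h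
      · norm_num at h
      · exact h11 h) (by norm_num)
  have hfix : ∀ x, x ^ (20 * n) = 1 → σ x = x := fun x hx =>
    algEquiv_fixes_of_mem_adjoin σ (by simpa using h1) (hω.mem_adjoin_of_pow_eq_one hN hx)
  have h5 := algEquiv_fixes_of_mem_adjoin σ (by simpa using h1)
    (sqrt_five_mem_adjoin hω hN ⟨4 * n, by ring⟩)
  have hz := hfix ζ (by rw [mul_comm, pow_mul, hζ.pow_eq_one, one_pow])
  have hI := hfix Complex.I (by
    rw [show 20 * n = 4 * (5 * n) by ring, pow_mul, Complex.I_pow_four, one_pow])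
  have hg0 : gaussEleven η ≠ 0 := fun h0 => by simpa [h0] using gaussEleven_sq hη
  refine not_mem_of_algEquiv_eq_neg σ (by rintro x (rfl | rfl) <;> assumption) ?_
    (mul_ne_zero (zpow_ne_zero _ Complex.I_ne_zero) (zpow_ne_zero _ hg0)) h
  rw [map_mul, map_zpow₀, map_zpow₀, hI, algEquiv_gaussEleven hη h2, hb.neg_zpow, mul_neg]

/-- If `4 ∤ n`, some automorphism fixes `√5` and `ζ_n`, and also `√-11` when `11 ∣ n`, but changes
the sign of `i`. -/
theorem four_dvd_of_mem {n : ℕ} (hn : 0 < n) {ζ η : ℂ} (hζ : IsPrimitiveRoot ζ n)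
    (hη : IsPrimitiveRoot η 11) (hn2 : Even n) {a b : ℤ} (ha : Odd a) (hb : Odd b → 11 ∣ n)
    (h : Complex.I ^ a * gaussEleven η ^ b ∈ adjoin ℚ {(Real.sqrt 5 : ℂ), ζ}) : 4 ∣ n := by
  by_contra h4
  obtain ⟨m, hm⟩ := hn2
  have hmodd : Odd m := by
    rw [← Nat.not_even_iff_odd]
    rintro ⟨k, rfl⟩
    exact h4 ⟨k, by omega⟩
  have hm0 : 0 < m := by omega
  have hN : 0 < 5 * m := by positivity
  have hω := Complex.isPrimitiveRoot_exp (5 * m) hN.ne'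
  have hI4 : IsPrimitiveRoot Complex.I 4 := by
    refine IsPrimitiveRoot.mk_of_lt _ (by norm_num) Complex.I_pow_four fun l hl0 hl4 => ?_
    interval_cases l <;> norm_num [Complex.ext_iff, pow_succ]
  obtain ⟨σ, h1, h2⟩ := hω.exists_algEquiv_eq_self_and_eq_pow hI4 hN (by norm_num)
    (e := 3) (Nat.Coprime.pow_right 2 (Nat.coprime_two_right.2 ((by decide : Odd 5).mul hmodd)))
    (by norm_num)
  have hfix : ∀ x, x ^ (5 * m) = 1 → σ x = x := fun x hx =>
    algEquiv_fixes_of_mem_adjoin σ (by simpa using h1) (hω.mem_adjoin_of_pow_eq_one hN hx)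
  have h5 := algEquiv_fixes_of_mem_adjoin σ (by simpa using h1)
    (sqrt_five_mem_adjoin hω hN ⟨m, rfl⟩)
  have hI : σ Complex.I = -Complex.I := by rw [h2, Complex.I_pow_three]
  -- as `m` is odd, `ζ` is minus an even power of itself, and `ζ ^ 2` has order `m`
  have hz : σ ζ = ζ := by
    have hz2 : σ (ζ ^ 2) = ζ ^ 2 := hfix _ (by
      rw [← pow_mul, show 2 * (5 * m) = n * 5 by omega, pow_mul, hζ.pow_eq_one, one_pow])
    have hζm : ζ ^ m = -1 := by
      have := (hζ.pow hn (show n = m * 2 by omega)).eq_neg_one_of_two_right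
      exact this
    obtain ⟨k, hk⟩ := hmodd
    have hζk : ζ = -(ζ ^ 2) ^ (k + 1) := by
      rw [← pow_mul, show 2 * (k + 1) = m + 1 by omega, pow_succ, hζm]
      ring
    rw [hζk, map_neg, map_pow, hz2]
  have hg : σ (gaussEleven η ^ b) = gaussEleven η ^ b := by
    rcases Int.even_or_odd b with hb' | hb'
    · obtain ⟨k, rfl⟩ := hb'
      rw [← two_mul, zpow_mul]
      norm_cast
      rw [gaussEleven_sq hη, map_zpow₀, map_neg, map_ofNat]
    · obtain ⟨k, hk⟩ := (Nat.Coprime.dvd_of_dvd_mul_left (by norm_num : Nat.Coprime 11 2)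
        (by have := hb hb'; rwa [show n = 2 * m by omega] at this) : 11 ∣ m)
      have hη' : σ η = η := hfix η (by
        rw [hk, show 5 * (11 * k) = 11 * (5 * k) by ring, pow_mul, hη.pow_eq_one, one_pow])
      rw [map_zpow₀, algEquiv_fixes_of_mem_adjoin σ (S := {η}) (by simpa using hη')
        (gaussEleven_mem (mem_adjoin_simple_self ℚ η))]
  have hg0 : gaussEleven η ≠ 0 := fun h0 => by simpa [h0] using gaussEleven_sq hη
  refine not_mem_of_algEquiv_eq_neg σ (by rintro x (rfl | rfl) <;> assumption) ?_
    (mul_ne_zero (zpow_ne_zero _ Complex.I_ne_zero) (zpow_ne_zero _ hg0)) h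
  rw [map_mul, hg, map_zpow₀, hI, ha.neg_zpow, neg_mul]

/-- The least positive exponent `A` for which `ρ ^ A` lies in `ℚ(√5, ζ_n)`, where `ρ ^ n = r`. -/
def rExponent (n : ℕ) : ℕ := if 4 ∣ n then n / 2 else n

/-- The least positive exponent `B` for which `κ ^ B` lies in `ℚ(√5, ζ_n)`, where `κ ^ i = q`
and `i ∣ n`. -/
def qExponent (i n : ℕ) : ℕ := if Even i ∧ 11 ∣ n then i / 2 else i

theorem rExponent_dvd (n : ℕ) : rExponent n ∣ n := by
  unfold rExponent
  split_ifs with h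
  · exact Nat.div_dvd_of_dvd ((by norm_num : 2 ∣ 4).trans h)
  · exact dvd_rfl

theorem qExponent_dvd (i n : ℕ) : qExponent i n ∣ i := by
  unfold qExponent
  split_ifs with h
  · exact Nat.div_dvd_of_dvd h.1.two_dvd
  · exact dvd_rfl

theorem quadField_le_adjoin (ζ : ℂ) : quadField ≤ adjoin ℚ {(Real.sqrt 5 : ℂ), ζ} :=
  adjoin.mono _ _ _ (by simp)

theorem root_of_unity_mem {n : ℕ} (hn : 0 < n) {ζ : ℂ} (hζ : IsPrimitiveRoot ζ n) {x : ℂ}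
    (hx : x ^ n = 1) : x ∈ adjoin ℚ {(Real.sqrt 5 : ℂ), ζ} :=
  adjoin.mono _ _ _ (by simp) (hζ.mem_adjoin_of_pow_eq_one hn hx)

theorem mem_of_sq_eq_sq {L : IntermediateField ℚ ℂ} {x y : ℂ} (h : x ^ 2 = y ^ 2) (hy : y ∈ L) :
    x ∈ L := by
  rcases sq_eq_sq_iff_eq_or_eq_neg.1 h with h | h <;> rw [h]
  exacts [hy, neg_mem hy]

theorem pow_rExponent_mem {n : ℕ} (hn : 0 < n) {ζ ρ : ℂ} (hζ : IsPrimitiveRoot ζ n)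
    (hρ : ρ ^ n = rElt) : ρ ^ rExponent n ∈ adjoin ℚ {(Real.sqrt 5 : ℂ), ζ} := by
  unfold rExponent
  split_ifs with h
  · obtain ⟨k, rfl⟩ := h
    have hI : Complex.I ^ (4 * k) = 1 := by rw [pow_mul, Complex.I_pow_four, one_pow]
    refine mem_of_sq_eq_sq (y := Complex.I * goldenUnit) ?_ (mul_mem (root_of_unity_mem hn hζ hI)
      (quadField_le_adjoin ζ goldenUnit_mem_quadField))
    rw [← rElt_eq_sq, ← hρ, ← pow_mul]
    congr 1
    omega
  · rw [hρ]
    exact quadField_le_adjoin ζ rElt_mem_quadField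

theorem primeElevenConj_mem_quadField : primeElevenConj ∈ quadField :=
  sub_mem (one_mem _) (mul_mem (ofNat_mem _ 3) goldenUnitConj_mem_quadField)

theorem pow_qExponent_mem {i n : ℕ} (hn : 0 < n) {ζ κ : ℂ} (hζ : IsPrimitiveRoot ζ n)
    (hκ : κ ^ i = qElt) : κ ^ qExponent i n ∈ adjoin ℚ {(Real.sqrt 5 : ℂ), ζ} := by
  unfold qExponent
  split_ifs with h
  · obtain ⟨⟨m, rfl⟩, k, rfl⟩ := h
    have hη := Complex.isPrimitiveRoot_exp 11 (by norm_num)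
    refine mem_of_sq_eq_sq (y := gaussEleven _ / primeElevenConj) ?_ (div_mem
      (gaussEleven_mem (root_of_unity_mem hn hζ (by rw [pow_mul, hη.pow_eq_one, one_pow])))
      (quadField_le_adjoin ζ primeElevenConj_mem_quadField))
    rw [← qElt_eq_sq hη, ← hκ, ← pow_mul]
    congr 1
    omega
  · rw [hκ]
    exact quadField_le_adjoin ζ qElt_mem_quadField

/-- The monomials `ρ ^ a * κ ^ b` in `ℚ(√5, ζ_n)` are those generated by `ρ ^ A` and `κ ^ B`, for
`A = rExponent n` and `B = qExponent i n`. -/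
theorem exponent_dvd_of_mem {i j : ℕ} (hi : 1 ≤ i) (hj : 1 ≤ j) {ζ ρ κ : ℂ}
    (hζ : IsPrimitiveRoot ζ (i * j)) (hρ : ρ ^ (i * j) = rElt) (hκ : κ ^ i = qElt) {a b : ℤ}
    (hy : ρ ^ a * κ ^ b ∈ adjoin ℚ {(Real.sqrt 5 : ℂ), ζ}) :
    (rExponent (i * j) : ℤ) ∣ a ∧ (qExponent i (i * j) : ℤ) ∣ b := by
  obtain ⟨⟨a', ha⟩, ⟨b', hb⟩⟩ := two_mul_dvd_of_mem hi hj hζ hρ hκ hy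
  set n := i * j with hn
  have hn0 : 0 < n := Nat.mul_pos hi hj
  have hη := Complex.isPrimitiveRoot_exp 11 (by norm_num)
  set η := Complex.exp (2 * Real.pi * Complex.I / ((11 : ℕ) : ℂ))
  -- the square of `y = ρ ^ a * κ ^ b` is `r ^ a' * q ^ b'`, and up to squares in `ℚ(√5)` one has
  -- `r ~ -1` and `q ~ -11`
  have hmem : Complex.I ^ a' * gaussEleven η ^ b' ∈ adjoin ℚ {(Real.sqrt 5 : ℂ), ζ} := by
    have h1 : (Complex.I * goldenUnit) ^ a' * (gaussEleven η / primeElevenConj) ^ b' ∈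
        adjoin ℚ {(Real.sqrt 5 : ℂ), ζ} := by
      refine mem_of_sq_eq_sq ?_ hy
      have h2 : ∀ (z : ℂ) (e : ℤ), (z ^ e) ^ 2 = (z ^ 2) ^ e := fun z e => by
        rw [← zpow_natCast, zpow_comm, zpow_natCast]
      rw [mul_pow, mul_pow, h2, h2, ← rElt_eq_sq, ← qElt_eq_sq hη, ← hρ, ← hκ, ← zpow_natCast,
        ← zpow_natCast, ← zpow_natCast, ← zpow_natCast, ← zpow_mul, ← zpow_mul, ← zpow_mul,
        ← zpow_mul, ← ha, ← hb]
      push_cast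
      rw [mul_comm a, mul_comm b]
    have h3 : Complex.I ^ a' * gaussEleven η ^ b' =
        (Complex.I * goldenUnit) ^ a' * (gaussEleven η / primeElevenConj) ^ b' /
          (goldenUnit ^ a' / primeElevenConj ^ b') := by
      have := goldenUnit_ne_zero
      have := primeElevenConj_ne_zero
      rw [mul_zpow, div_zpow]
      field_simp
    rw [h3]
    have hK := quadField_le_adjoin ζ
    exact div_mem h1 (div_mem (zpow_mem (hK goldenUnit_mem_quadField) _)
      (zpow_mem (hK primeElevenConj_mem_quadField) _))
  have h11 : Odd b' → 11 ∣ n := fun h => eleven_dvd_of_mem hn0 hζ hη h hmem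
  constructor
  · unfold rExponent
    split_ifs with h4
    · refine ⟨a', ?_⟩
      obtain ⟨k, hk⟩ := h4
      rw [hk] at ha ⊢
      rw [show 4 * k / 2 = 2 * k by omega]
      push_cast at ha ⊢
      linarith
    · rcases Int.even_or_odd a' with ⟨k, hk⟩ | hodd
      · exact ⟨k, by rw [hk] at ha; linarith⟩
      · refine absurd (four_dvd_of_mem hn0 hζ hη ?_ hodd h11 hmem) h4
        have h2 : Even ((n : ℤ) * a') := ha ▸ even_two_mul a
        rcases Int.even_mul.1 h2 with h | h
        · exact_mod_cast h
        · exact absurd hodd (Int.not_odd_iff_even.2 h)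
  · unfold qExponent
    split_ifs with h
    · refine ⟨b', ?_⟩
      obtain ⟨⟨k, hk⟩, -⟩ := h
      rw [hk] at hb ⊢
      rw [show (k + k) / 2 = k by omega]
      push_cast at hb ⊢
      linarith
    · rcases Int.even_or_odd b' with ⟨k, hk⟩ | hodd
      · exact ⟨k, by rw [hk] at hb; linarith⟩
      · refine absurd ⟨?_, h11 hodd⟩ h
        have h2 : Even ((i : ℤ) * b') := hb ▸ even_two_mul b
        rcases Int.even_mul.1 h2 with h | h
        · exact_mod_cast h
        · exact absurd hodd (Int.not_odd_iff_even.2 h)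

/-! ### The degree of the radical field -/

theorem finrank_radicalField {i j : ℕ} (hi : 1 ≤ i) (hj : 1 ≤ j) {ζ ρ κ : ℂ}
    (hζ : IsPrimitiveRoot ζ (i * j)) (hρ : ρ ^ (i * j) = rElt) (hκ : κ ^ i = qElt) :
    Module.finrank ℚ (radicalField ζ ρ κ) =
      Module.finrank ℚ (adjoin ℚ {(Real.sqrt 5 : ℂ), ζ}) *
        (rExponent (i * j) * qExponent i (i * j)) := by
  have hn0 : 0 < i * j := Nat.mul_pos hi hj
  let M : IntermediateField ℚ ℂ := adjoin ℚ {(Real.sqrt 5 : ℂ), ζ}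
  have hfield : radicalField ζ ρ κ = (adjoin M {ρ, κ}).restrictScalars ℚ := by
    refine (adjoin_adjoin_left ℚ _ _).trans (Eq.trans ?_ (adjoin_adjoin_left ℚ _ _).symm)
    congr 1
    ext
    simp only [Set.mem_union, Set.mem_insert_iff, Set.mem_singleton_iff]
    tauto
  have : Algebra.IsAlgebraic ℚ M := isAlgebraic_adjoin (by
    rintro x (rfl | rfl)
    · exact isIntegral_sqrt_five
    · exact (hζ.isIntegral hn0).tower_top)
  have : Countable M := countable_of_isAlgebraic ℚ M
  have hrange : ∀ x : ℂ, x ∈ (algebraMap M ℂ).range ↔ x ∈ M :=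
    fun x => ⟨fun ⟨y, hy⟩ => hy ▸ y.2, fun hx => ⟨⟨x, hx⟩, rfl⟩⟩
  have hζM : ζ ∈ M := subset_adjoin _ _ (by simp)
  have hζ' : IsPrimitiveRoot (⟨ζ, hζM⟩ : M) (i * j) :=
    IsPrimitiveRoot.of_map_of_injective (f := algebraMap M ℂ) hζ (algebraMap M ℂ).injective
  have hρ0 : ρ ≠ 0 := by
    rintro rfl
    exact rElt_ne_zero (by rw [← hρ, zero_pow hn0.ne'])
  have hκ0 : κ ≠ 0 := by
    rintro rfl
    exact qElt_ne_zero (by rw [← hκ, zero_pow (by omega)])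
  have hpair : Module.finrank M (adjoin M {ρ, κ}) = rExponent (i * j) * qExponent i (i * j) := by
    refine finrank_adjoin_pair_eq_mul hn0 hζ' hρ0 hκ0 (rExponent_dvd _)
      ((qExponent_dvd i _).trans (dvd_mul_right i j)) ((hrange _).2 (pow_rExponent_mem hn0 hζ hρ))
      ((hrange _).2 (pow_qExponent_mem hn0 hζ hκ)) fun a b hab => ?_
    exact exponent_dvd_of_mem hi hj hζ hρ hκ ((hrange _).1 hab)
  rw [hfield, ← hpair]
  exact (Module.finrank_mul_finrank ℚ M (adjoin M {ρ, κ})).symm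

theorem two_pow_tExp (i j : ℕ) :
    2 ^ tExp i j = (if 5 ∣ i * j then 2 else 1) * (if 4 ∣ i * j then 2 else 1) *
      (if Even i ∧ 11 ∣ i * j then 2 else 1) := by
  unfold tExp
  by_cases h4 : 4 ∣ i * j
  · have h2 : Even i ∨ Even j := Nat.even_mul.1 (even_iff_two_dvd.2 ((by norm_num : 2 ∣ 4).trans h4))
    by_cases hi : Even i
    · by_cases h5 : 5 ∣ i * j <;> by_cases h11 : 11 ∣ i * j <;>
        simp [Finset.filter_insert, Finset.filter_singleton, h4, h5, h11, hi]
    · have hj := h2.resolve_left hi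
      by_cases h5 : 5 ∣ i * j <;>
        simp [Finset.filter_insert, Finset.filter_singleton, h4, h5, hi, hj]
  · by_cases hi : Even i <;> by_cases hj : Even j <;> by_cases h5 : 5 ∣ i * j <;>
      by_cases h11 : 11 ∣ i * j <;>
        simp [Finset.filter_insert, Finset.filter_singleton, h4, h5, h11, hi, hj]

theorem rExponent_mul (n : ℕ) : rExponent n * (if 4 ∣ n then 2 else 1) = n := by
  unfold rExponent
  split_ifs with h
  · exact Nat.div_mul_cancel ((by norm_num : 2 ∣ 4).trans h)
  · exact mul_one n

theorem qExponent_mul (i n : ℕ) :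
    qExponent i n * (if Even i ∧ 11 ∣ n then 2 else 1) = i := by
  unfold qExponent
  split_ifs with h
  · exact Nat.div_mul_cancel h.1.two_dvd
  · exact mul_one i

theorem mainTheorem2 (i j : ℕ) (hi : 1 ≤ i) (hj : 1 ≤ j) (ζ ρ κ : ℂ)
    (hζ : IsPrimitiveRoot ζ (i * j)) (hρ : ρ ^ (i * j) = rElt) (hκ : κ ^ i = qElt) :
    (Module.finrank ℚ (radicalField ζ ρ κ) : ℚ) =
      2 ^ (1 - (tExp i j : ℤ)) * (i : ℚ) ^ 2 * (j : ℚ) * (Nat.totient (i * j) : ℚ) := by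
  have h : Module.finrank ℚ (radicalField ζ ρ κ) * 2 ^ tExp i j =
      2 * i ^ 2 * j * (i * j).totient := by
    have h1 := finrank_adjoin_sqrt_five_root_of_unity hζ (Nat.mul_pos hi hj)
    have h2 := rExponent_mul (i * j)
    have h3 := qExponent_mul i (i * j)
    rw [finrank_radicalField hi hj hζ hρ hκ, two_pow_tExp]
    calc _ = (Module.finrank ℚ (adjoin ℚ {(Real.sqrt 5 : ℂ), ζ}) * (if 5 ∣ i * j then 2 else 1)) *
          (rExponent (i * j) * (if 4 ∣ i * j then 2 else 1)) *
          (qExponent i (i * j) * (if Even i ∧ 11 ∣ i * j then 2 else 1)) := by ring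
      _ = _ := by rw [h1, h2, h3]; ring
  have h' : (Module.finrank ℚ (radicalField ζ ρ κ) : ℚ) * 2 ^ tExp i j =
      2 * i ^ 2 * j * (i * j).totient := by exact_mod_cast h
  rw [zpow_sub₀ two_ne_zero, zpow_one, zpow_natCast, div_mul_eq_mul_div, div_mul_eq_mul_div,
    div_mul_eq_mul_div, eq_div_iff (by positivity), h']
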